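/- **Setting.** For each $N$ let $U_N=\{1,\dots,N\}$, and let $A\subset U_N$ be a random sample drawn by rejective (conditional Poisson) sampling of fixed size $n=n_N$: there are weights $\omega_i=\omega_{i,N}>0$ with $$\mathbb P(A=s)=\frac{\prod_{i\in s}\omega_i}{\sum_{t\subset U_N,\ |t|=n}\prod_{j\in t}\omega_j}\qquad\text{for all } s\subset U_N,\ |s|=n .$$ Write $I_i=\mathbf 1(i\in A)$ and $\pi_i=\mathbb P(I_i=1)$. Independently of $A$, let $\kappa=(\kappa_i)_{i\in U_N}$ be (random or nonrandom) fold labels in $\{1,\dots,K\}$, $K=K_N$, let $U_k=\{i\in U_N:\kappa_i=k\}$ and $N_k=|U_k|$ be the folds and their sizes, and let $$\mathcal G_k=\sigma\big(\kappa,\{I_j:j\in U_N\setminus U_k\}\big).$$ For a $\mathcal G_k$-measurable real array $a=(a_i)_{i\in U_k}$ put $D_k=D_k(a)=N_k^{-1}\sum_{i\in U_k}(I_i/\pi_i-1)a_i$ (with $D_k=0$ and $N_k^{-1}\sum_{i\in U_k}a_i^2=0$ if $U_k=\emptyset$). **Assumptions.** There are constants $0<\pi_{\min}\le\pi_{\max}<1$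 with $\pi_{\min}\le\pi_i\le\pi_{\max}$ for all $i\in U_N$ and all sufficiently large $N$, and $n/N\to f\in(0,1)$ as $N\to\infty$. **Proposition 3.** (i) Fix a fold $k$ (for each $N$, an index $k=k_N\in\{1,\dots,K_N\}$) that is balanced: for some constants $0<c<C<\infty$, $\mathbb P(cN\le N_k\le CN)\to1$ (for nonrandom folds: $cN\le N_k\le CN$ for all large $N$). Then for every $\eta>0$ there are $C_\eta<\infty$ and $N_\eta$ such that for all $N\ge N_\eta$ and every $\mathcal G_k$-measurable array $a$, $$\mathbb P\Big(\mathbb E\big(D_k^2\mid\mathcal G_k\big)\le\frac{C_\eta}{n}\cdot\frac1{N_k}\sum_{i\in U_k}a_i^2\Big)\ge1-\eta .$$ (ii) If all folds are balanced, that is, $\mathbb P(cN\le N_k\le CN\text{ for all }k\le K)\to1$ for some constants $0<c<C<\infty$, then the fold-wise conditional fluctuation bound (A2$^*$) holds: for every $0<\eta<1$ there are $C_\eta<\infty$ and $N_\eta$ such that for every $N\ge N_\eta$ there is an event $E$ with $\mathbb P(E)\ge1-\eta$ on which, for each $k=1,\dots,K$ and each $\mathcal G_k$-measurable array $a$, almost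 surely $$\mathbb E\big(D_k(a)^2\mid\mathcal G_k\big)\le\frac{C_\eta}{n}\cdot\frac1{N_k}\sum_{i\in U_k}a_i^2 .$$ -/

import Mathlib

open MeasureTheory ProbabilityTheory Filter Topology

noncomputable section

namespace SurveySampling

section Single

variable {Ω : Type*} [MeasurableSpace Ω] {N K : ℕ}

/-- The sample membership indicator `I_i`. -/
def incl (A : Ω → Finset (Fin N)) (i : Fin N) (ω : Ω) : ℝ :=
  if i ∈ A ω then 1 else 0

/-- The first-order inclusion probability `π_i = P(I_i = 1)`. -/
def inclProb (P : Measure Ω) (A : Ω → Finset (Fin N)) (i : Fin N) : ℝ :=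
  P.real {ω | i ∈ A ω}

/-- The normalizing constant `Z_n`: the sum over all `t` with `|t| = n` of `∏_{j ∈ t} w_j`. -/
def rejectiveNorm (n : ℕ) (w : Fin N → ℝ) : ℝ :=
  ∑ t ∈ (Finset.univ : Finset (Fin N)).powersetCard n, ∏ j ∈ t, w j

/-- Under `P` the random sample `A` is a rejective (conditional Poisson) sample of fixed size `n`
with odds weights `w`. -/
structure IsRejective (P : Measure Ω) (A : Ω → Finset (Fin N)) (n : ℕ) (w : Fin N → ℝ) :
    Prop where
  weight_pos : ∀ i, 0 < w i
  size : ∀ᵐ ω ∂P, (A ω).card = n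
  law : ∀ s : Finset (Fin N), s.card = n →
    P.real {ω | A ω = s} = (∏ i ∈ s, w i) / rejectiveNorm n w

/-- The fold `U_k = {i : κ_i = k}`. -/
def fold (κ : Ω → Fin N → Fin K) (k : Fin K) (ω : Ω) : Finset (Fin N) :=
  Finset.univ.filter fun i => κ ω i = k

/-- The training sigma-field `σ(κ, {I_j : j ∉ U_k})`. The out-of-fold indicators
are recorded as the set `A \ U_k`, which, jointly with `κ`, carries the same information. -/
@[reducible]
def trainField (A : Ω → Finset (Fin N)) (κ : Ω → Fin N → Fin K) (k : Fin K) :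
    MeasurableSpace Ω :=
  MeasurableSpace.comap (fun ω => (κ ω, A ω \ fold κ k ω)) inferInstance

/-- `D_k = N_k⁻¹ ∑_{i ∈ U_k} (I_i / π_i - 1) a_i`. -/
def fluct (P : Measure Ω) (A : Ω → Finset (Fin N)) (κ : Ω → Fin N → Fin K) (k : Fin K)
    (a : Fin N → Ω → ℝ) (ω : Ω) : ℝ :=
  ((fold κ k ω).card : ℝ)⁻¹ *
    ∑ i ∈ fold κ k ω, (incl A i ω / inclProb P A i - 1) * a i ω

/-- `N_k⁻¹ ∑_{i ∈ U_k} a_i²`. -/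
def foldMeanSq (κ : Ω → Fin N → Fin K) (k : Fin K) (a : Fin N → Ω → ℝ) (ω : Ω) : ℝ :=
  ((fold κ k ω).card : ℝ)⁻¹ * ∑ i ∈ fold κ k ω, a i ω ^ 2

end Single

section Sequence

variable {Ω : ℕ → Type*} [∀ N, MeasurableSpace (Ω N)] {K : ℕ → ℕ}

/-- The fold `k` is balanced: `c N ≤ N_k ≤ C N` with probability tending to one. For nonrandom
folds this says that these inequalities hold for all large `N`. -/
def BalancedFold (P : ∀ N, Measure (Ω N)) (κ : ∀ N, Ω N → Fin N → Fin (K N))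
    (k : ∀ N, Fin (K N)) : Prop :=
  ∃ c C : ℝ, 0 < c ∧ c < C ∧
    Tendsto (fun N : ℕ => (P N).real
      {ω | c * N ≤ ((fold (κ N) (k N) ω).card : ℝ) ∧ ((fold (κ N) (k N) ω).card : ℝ) ≤ C * N})
      atTop (𝓝 1)

/-- All folds are simultaneously balanced. -/
def BalancedFolds (P : ∀ N, Measure (Ω N)) (κ : ∀ N, Ω N → Fin N → Fin (K N)) : Prop :=
  ∃ c C : ℝ, 0 < c ∧ c < C ∧
    Tendsto (fun N : ℕ => (P N).real
      {ω | ∀ k : Fin (K N),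
        c * N ≤ ((fold (κ N) k ω).card : ℝ) ∧ ((fold (κ N) k ω).card : ℝ) ≤ C * N})
      atTop (𝓝 1)

/-- The fold-wise conditional fluctuation bound. The event `E` is common to all folds and all
arrays. -/
def FoldwiseFluctuationBound (P : ∀ N, Measure (Ω N)) (A : ∀ N, Ω N → Finset (Fin N))
    (κ : ∀ N, Ω N → Fin N → Fin (K N)) (n : ℕ → ℕ) : Prop :=
  ∀ η : ℝ, 0 < η → η < 1 → ∃ Cη : ℝ, ∃ Nη : ℕ, ∀ N ≥ Nη,
    ∃ E : Set (Ω N), MeasurableSet E ∧ 1 - η ≤ (P N).real E ∧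
      ∀ (k : Fin (K N)) (a : Fin N → Ω N → ℝ),
        (∀ i, Measurable[trainField (A N) (κ N) k] (a i)) →
        ∀ᵐ ω ∂(P N), ω ∈ E →
          ((P N)[fun ω' => fluct (P N) (A N) (κ N) k a ω' ^ 2 | trainField (A N) (κ N) k]) ω
            ≤ Cη / n N * foldMeanSq (κ N) k a ω

end Sequence

end SurveySampling

end

noncomputable section

namespace SurveySampling

section ElementarySymmetric

variable {ι : Type*}

/-- The weight `∏_{i ∈ t} w_i` of a set `t` of size `m`, and zero for sets of other sizes. -/
def sizeWeight (w : ι → ℝ) (m : ℤ) (t : Finset ι) : ℝ :=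
  if (t.card : ℤ) = m then ∏ i ∈ t, w i else 0

/-- The elementary symmetric polynomial of degree `m` in the weights indexed by `S`. Integer
degrees make the Pascal recursion uniform. -/
def esp (w : ι → ℝ) (S : Finset ι) (m : ℤ) : ℝ :=
  ∑ t ∈ S.powerset, sizeWeight w m t

lemma sizeWeight_nonneg {w : ι → ℝ} (hw : ∀ i, 0 < w i) (m : ℤ) (t : Finset ι) :
    0 ≤ sizeWeight w m t := by
  unfold sizeWeight
  split_ifs
  · exact Finset.prod_nonneg fun i _ => (hw i).le
  · exact le_rfl

lemma sizeWeight_mul_congr (w : ι → ℝ) {m : ℤ} {t : Finset ι} {x y : ℝ}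
    (h : (t.card : ℤ) = m → x = y) : sizeWeight w m t * x = sizeWeight w m t * y := by
  unfold sizeWeight
  split_ifs with h'
  · rw [h h']
  · simp

lemma esp_nonneg {w : ι → ℝ} (hw : ∀ i, 0 < w i) (S : Finset ι) (m : ℤ) : 0 ≤ esp w S m :=
  Finset.sum_nonneg fun t _ => sizeWeight_nonneg hw m t

lemma esp_pos {w : ι → ℝ} (hw : ∀ i, 0 < w i) {S : Finset ι} {m : ℤ} (h0 : 0 ≤ m)
    (h1 : m ≤ S.card) : 0 < esp w S m := by
  obtain ⟨t, hts, ht⟩ := Finset.exists_subset_card_eq (s := S) (n := m.toNat) (by omega)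
  refine Finset.sum_pos' (fun t _ => sizeWeight_nonneg hw m t)
    ⟨t, Finset.mem_powerset.2 hts, ?_⟩
  rw [sizeWeight, if_pos (by omega)]
  exact Finset.prod_pos fun i _ => hw i

variable [DecidableEq ι]

/-- The membership indicator of `i` in `t`. -/
def memInd (i : ι) (t : Finset ι) : ℝ := if i ∈ t then 1 else 0

/-- The inclusion probability of `i` under rejective sampling of size `m` from `S`. -/
def rejIncl (w : ι → ℝ) (S : Finset ι) (m : ℤ) (i : ι) : ℝ :=
  w i * esp w (S.erase i) (m - 1) / esp w S m

lemma sizeWeight_insert (w : ι → ℝ) (m : ℤ) {i : ι} {t : Finset ι} (hi : i ∉ t) :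
    sizeWeight w m (insert i t) = w i * sizeWeight w (m - 1) t := by
  unfold sizeWeight
  rw [Finset.card_insert_of_notMem hi, Finset.prod_insert hi]
  push_cast
  by_cases h : (t.card : ℤ) = m - 1
  · rw [if_pos h, if_pos (by omega)]
  · rw [if_neg h, if_neg (by omega), mul_zero]

lemma esp_insert (w : ι → ℝ) (m : ℤ) {i : ι} {S : Finset ι} (hi : i ∉ S) :
    esp w (insert i S) m = esp w S m + w i * esp w S (m - 1) := by
  unfold esp
  rw [Finset.sum_powerset_insert hi, Finset.mul_sum]
  congr 1
  refine Finset.sum_congr rfl fun t ht => sizeWeight_insert w m ?_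
  exact fun h => hi (Finset.mem_powerset.1 ht h)

lemma esp_logConcave {w : ι → ℝ} (hw : ∀ i, 0 < w i) (S : Finset ι) :
    ∀ a b : ℤ, a ≤ b → esp w S (a - 1) * esp w S (b + 1) ≤ esp w S a * esp w S b := by
  induction S using Finset.induction_on with
  | empty =>
    intro a b hab
    have h : ∀ m : ℤ, esp w ∅ m = if m = 0 then 1 else 0 := by
      intro m
      simp [esp, sizeWeight, eq_comm]
    have h0 : ∀ m : ℤ, 0 ≤ esp w (∅ : Finset ι) m := esp_nonneg hw ∅
    by_cases hb : b + 1 = 0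
    · rw [h (a - 1), if_neg (by omega), zero_mul]
      exact mul_nonneg (h0 _) (h0 _)
    · rw [h (b + 1), if_neg hb, mul_zero]
      exact mul_nonneg (h0 _) (h0 _)
  | insert i S hi ih =>
    intro a b hab
    have hwi := (hw i).le
    rw [esp_insert w _ hi, esp_insert w _ hi, esp_insert w _ hi, esp_insert w _ hi]
    have h1 := ih a b hab
    have h2 := ih (a - 1) (b - 1) (by omega)
    have h3 : esp w S (a - 1 - 1) * esp w S (b + 1) ≤ esp w S a * esp w S (b - 1) := by
      rcases hab.lt_or_eq with h | rfl
      · have e1 := ih a (b - 1) (by omega)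
        have e2 := ih (a - 1) b (by omega)
        rw [sub_add_cancel] at e1
        exact e2.trans e1
      · have e2 := ih (a - 1) a (by omega)
        linarith
    rw [sub_add_cancel] at h2
    rw [add_sub_cancel_right]
    have h4 := mul_le_mul_of_nonneg_left h3 hwi
    have h5 := mul_le_mul_of_nonneg_left h2 (mul_nonneg hwi hwi)
    nlinarith

lemma sum_sizeWeight_erase (w : ι → ℝ) {S : Finset ι} (m : ℤ) {i : ι} (hi : i ∈ S)
    (F : Finset ι → ℝ) :
    ∑ t ∈ S.powerset, sizeWeight w m t * (memInd i t * F t) =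
      w i * ∑ t ∈ (S.erase i).powerset, sizeWeight w (m - 1) t * F (insert i t) := by
  conv_lhs => rw [← Finset.insert_erase hi]
  rw [Finset.sum_powerset_insert (Finset.notMem_erase i S), Finset.mul_sum]
  have hnot : ∀ t ∈ (S.erase i).powerset, i ∉ t := fun t ht h =>
    Finset.notMem_erase i S (Finset.mem_powerset.1 ht h)
  rw [Finset.sum_eq_zero, zero_add]
  · refine Finset.sum_congr rfl fun t ht => ?_
    rw [sizeWeight_insert w m (hnot t ht), memInd, if_pos (Finset.mem_insert_self i t)]
    ring
  · intro t ht
    rw [memInd, if_neg (hnot t ht)]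
    ring

lemma sum_sizeWeight_memInd (w : ι → ℝ) {S : Finset ι} (m : ℤ) {i : ι} (hi : i ∈ S) :
    ∑ t ∈ S.powerset, sizeWeight w m t * memInd i t = w i * esp w (S.erase i) (m - 1) := by
  have := sum_sizeWeight_erase w m hi fun _ => 1
  simpa [esp] using this

lemma sum_sizeWeight_memInd_pair (w : ι → ℝ) {S : Finset ι} (m : ℤ) {i j : ι} (hi : i ∈ S)
    (hj : j ∈ S) (hij : i ≠ j) :
    ∑ t ∈ S.powerset, sizeWeight w m t * (memInd i t * memInd j t) =
      w i * (w j * esp w ((S.erase i).erase j) (m - 1 - 1)) := by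
  rw [sum_sizeWeight_erase w m hi, ← sum_sizeWeight_memInd w (m - 1)
    (Finset.mem_erase.2 ⟨hij.symm, hj⟩)]
  congr 1
  refine Finset.sum_congr rfl fun t _ => ?_
  simp [memInd, hij.symm]

lemma esp_eq_erase (w : ι → ℝ) {S : Finset ι} (m : ℤ) {i : ι} (hi : i ∈ S) :
    esp w S m = esp w (S.erase i) m + w i * esp w (S.erase i) (m - 1) := by
  conv_lhs => rw [← Finset.insert_erase hi]
  exact esp_insert w m (Finset.notMem_erase i S)

lemma memInd_sum_eq_rejIncl {w : ι → ℝ} (hw : ∀ i, 0 < w i) {S : Finset ι} (m : ℤ) {i : ι}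
    (hi : i ∈ S) :
    ∑ t ∈ S.powerset, sizeWeight w m t * memInd i t = esp w S m * rejIncl w S m i := by
  rw [sum_sizeWeight_memInd w m hi, rejIncl]
  by_cases h : esp w S m = 0
  · have h1 := esp_eq_erase w m hi
    have h2 := esp_nonneg hw (S.erase i) m
    have h3 := mul_nonneg (hw i).le (esp_nonneg hw (S.erase i) (m - 1))
    rw [h, zero_mul]
    linarith
  · field_simp

/-- Pairwise negative correlation of rejective sampling. -/
lemma pair_sum_mul_esp_le {w : ι → ℝ} (hw : ∀ i, 0 < w i) {S : Finset ι} (m : ℤ) {i j : ι}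
    (hi : i ∈ S) (hj : j ∈ S) (hij : i ≠ j) :
    (∑ t ∈ S.powerset, sizeWeight w m t * (memInd i t * memInd j t)) * esp w S m ≤
      (∑ t ∈ S.powerset, sizeWeight w m t * memInd i t) *
        ∑ t ∈ S.powerset, sizeWeight w m t * memInd j t := by
  have hj' : j ∈ S.erase i := Finset.mem_erase.2 ⟨hij.symm, hj⟩
  have hi' : i ∈ S.erase j := Finset.mem_erase.2 ⟨hij, hi⟩
  rw [sum_sizeWeight_memInd_pair w m hi hj hij, sum_sizeWeight_memInd w m hi,
    sum_sizeWeight_memInd w m hj, esp_eq_erase w m hi, esp_eq_erase w m hj',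
    esp_eq_erase w (m - 1) hj', esp_eq_erase w (m - 1) hi', Finset.erase_right_comm (a := j)]
  have h := esp_logConcave hw ((S.erase i).erase j) (m - 1) (m - 1) le_rfl
  rw [sub_add_cancel] at h
  have h' := mul_le_mul_of_nonneg_left h (mul_nonneg (hw i).le (hw j).le)
  nlinarith

lemma rejIncl_nonneg {w : ι → ℝ} (hw : ∀ i, 0 < w i) (S : Finset ι) (m : ℤ) (i : ι) :
    0 ≤ rejIncl w S m i :=
  div_nonneg (mul_nonneg (hw i).le (esp_nonneg hw _ _)) (esp_nonneg hw _ _)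

lemma rejIncl_le_one {w : ι → ℝ} (hw : ∀ i, 0 < w i) {S : Finset ι} (m : ℤ) {i : ι}
    (hi : i ∈ S) : rejIncl w S m i ≤ 1 := by
  refine div_le_one_of_le₀ ?_ (esp_nonneg hw _ _)
  rw [esp_eq_erase w m hi]
  linarith [esp_nonneg hw (S.erase i) m]

/-- A uniform positive lower bound on `π_i (1 - π_j)` bounds all weight ratios. -/
lemma weight_le_of_rejIncl {w : ι → ℝ} (hw : ∀ i, 0 < w i) {S : Finset ι} {m : ℤ} {p q : ℝ}
    (hp : 0 ≤ p) (hq : q ≤ 1) (hZ : 0 < esp w S m)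
    (hlow : ∀ i ∈ S, p ≤ rejIncl w S m i) (hup : ∀ i ∈ S, rejIncl w S m i ≤ q)
    {i j : ι} (hi : i ∈ S) (hj : j ∈ S) : p * (1 - q) * w i ≤ w j := by
  have hpi := hlow i hi
  have hpj := hlow j hj
  have hqi := hup i hi
  have h1q : 0 ≤ 1 - q := by linarith
  have hpq : p * (1 - q) ≤ 1 := by
    have := rejIncl_le_one hw m hi
    nlinarith
  by_cases hij : i = j
  · subst hij
    nlinarith [hw i]
  have hj' : j ∈ S.erase i := Finset.mem_erase.2 ⟨Ne.symm hij, hj⟩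
  have hi' : i ∈ S.erase j := Finset.mem_erase.2 ⟨hij, hi⟩
  have key := pair_sum_mul_esp_le hw m hi hj hij
  rw [memInd_sum_eq_rejIncl hw m hi, memInd_sum_eq_rejIncl hw m hj] at key
  set Z := esp w S m with hZdef
  set Q := ∑ t ∈ S.powerset, sizeWeight w m t * (memInd i t * memInd j t) with hQ
  have hQle : Q ≤ Z * (rejIncl w S m i * rejIncl w S m j) := by
    refine le_of_mul_le_mul_right ?_ hZ
    linarith
  have hQ2 := sum_sizeWeight_memInd_pair w m hi hj hij
  have hPj : Z * rejIncl w S m j = w j * esp w (S.erase j) (m - 1) := by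
    rw [← memInd_sum_eq_rejIncl hw m hj, sum_sizeWeight_memInd w m hj]
  rw [esp_eq_erase w (m - 1) hi', Finset.erase_right_comm] at hPj
  have hZ2 : Z = esp w (S.erase i) m + w i * esp w (S.erase i) (m - 1) := esp_eq_erase w m hi
  rw [esp_eq_erase w (m - 1) hj'] at hZ2
  have h0 := esp_nonneg hw (S.erase i) m
  set e := esp w ((S.erase i).erase j) (m - 1)
  set e' := esp w ((S.erase i).erase j) (m - 1 - 1)
  have he' : 0 ≤ e' := esp_nonneg hw _ _
  have hwe : w j * e = Z * rejIncl w S m j - Q := by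
    rw [hPj, hQ, hQ2]; ring
  have hge : Z * (p * (1 - q)) ≤ w j * e := by
    have : p * (1 - q) ≤ rejIncl w S m j * (1 - rejIncl w S m i) :=
      mul_le_mul hpj (by linarith) h1q (hp.trans hpj)
    nlinarith
  have hle : w i * e ≤ Z := by
    have : 0 ≤ w i * (w j * e') := mul_nonneg (hw i).le (mul_nonneg (hw j).le he')
    nlinarith
  refine le_of_mul_le_mul_left ?_ hZ
  calc Z * (p * (1 - q) * w i) = Z * (p * (1 - q)) * w i := by ring
    _ ≤ w j * e * w i := mul_le_mul_of_nonneg_right hge (hw i).le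
    _ = w i * e * w j := by ring
    _ ≤ Z * w j := mul_le_mul_of_nonneg_right hle (hw j).le

lemma memInd_sum (S t : Finset ι) (ht : t ⊆ S) : ∑ i ∈ S, memInd i t = t.card := by
  simp [memInd, Finset.inter_eq_right.2 ht]

lemma sum_rejIncl {w : ι → ℝ} (hw : ∀ i, 0 < w i) {S : Finset ι} {m : ℤ}
    (hZ : 0 < esp w S m) : ∑ i ∈ S, rejIncl w S m i = m := by
  have h : esp w S m * ∑ i ∈ S, rejIncl w S m i = esp w S m * m := by
    rw [Finset.mul_sum, Finset.sum_congr rfl fun i hi => (memInd_sum_eq_rejIncl hw m hi).symm,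
      Finset.sum_comm, esp, Finset.sum_mul]
    refine Finset.sum_congr rfl fun t ht => ?_
    rw [← Finset.mul_sum, memInd_sum S t (Finset.mem_powerset.1 ht), sizeWeight]
    split_ifs with h
    · rw [← h]; norm_num
    · simp
  exact mul_left_cancel₀ hZ.ne' h

/-- The Turán-type difference `e_m² - e_{m-1} e_{m+1}`. -/
def turan (w : ι → ℝ) (S : Finset ι) (m : ℤ) : ℝ :=
  esp w S m * esp w S m - esp w S (m - 1) * esp w S (m + 1)

lemma turan_nonneg {w : ι → ℝ} (hw : ∀ i, 0 < w i) (S : Finset ι) (m : ℤ) :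
    0 ≤ turan w S m := sub_nonneg.2 (esp_logConcave hw S m m le_rfl)

lemma rejIncl_succ_sub {w : ι → ℝ} {S : Finset ι} {m : ℤ}
    (h0 : esp w S m ≠ 0) (h1 : esp w S (m + 1) ≠ 0) {i : ι} (hi : i ∈ S) :
    rejIncl w S (m + 1) i - rejIncl w S m i =
      w i * turan w (S.erase i) m / (esp w S m * esp w S (m + 1)) := by
  unfold rejIncl turan
  rw [add_sub_cancel_right]
  rw [div_sub_div _ _ h1 h0, mul_comm (esp w S m) (esp w S (m + 1))]
  congr 1
  rw [esp_eq_erase w m hi, esp_eq_erase w (m + 1) hi, add_sub_cancel_right]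
  ring

lemma turan_erase_le {w : ι → ℝ} (hw : ∀ i, 0 < w i) {S : Finset ι} (m : ℤ) {i j : ι}
    (hi : i ∈ S) (hj : j ∈ S) {R : ℝ} (hR : 1 ≤ R) (hij : w i ≤ R * w j) (hji : w j ≤ R * w i) :
    w i * turan w (S.erase i) m ≤ R * (w j * turan w (S.erase j) m) := by
  by_cases h : i = j
  · subst h
    exact le_mul_of_one_le_left (mul_nonneg (hw i).le (turan_nonneg hw _ _)) hR
  have hj' : j ∈ S.erase i := Finset.mem_erase.2 ⟨Ne.symm h, hj⟩
  have hi' : i ∈ S.erase j := Finset.mem_erase.2 ⟨h, hi⟩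
  have expand : ∀ {l : ι} {T : Finset ι}, l ∈ T → turan w T m = turan w (T.erase l) m +
      w l * (esp w (T.erase l) (m - 1) * esp w (T.erase l) m -
        esp w (T.erase l) (m - 1 - 1) * esp w (T.erase l) (m + 1)) +
      w l * w l * turan w (T.erase l) (m - 1) := by
    intro l T hl
    unfold turan
    rw [esp_eq_erase w m hl, esp_eq_erase w (m - 1) hl, esp_eq_erase w (m + 1) hl,
      add_sub_cancel_right, sub_add_cancel]
    ring
  rw [expand hj', expand hi', Finset.erase_right_comm (a := j)]
  set V := (S.erase i).erase j
  have t0 := turan_nonneg hw V m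
  have t1 := turan_nonneg hw V (m - 1)
  have t2 : 0 ≤ esp w V (m - 1) * esp w V m - esp w V (m - 1 - 1) * esp w V (m + 1) :=
    sub_nonneg.2 (esp_logConcave hw V (m - 1) m (by omega))
  set s := esp w V (m - 1) * esp w V m - esp w V (m - 1 - 1) * esp w V (m + 1)
  have hwi := (hw i).le
  have hwj := (hw j).le
  have a0 := mul_le_mul_of_nonneg_right hij t0
  have a1 : w i * w j * s ≤ R * (w i * w j * s) :=
    le_mul_of_one_le_left (mul_nonneg (mul_nonneg hwi hwj) t2) hR
  have a2 := mul_le_mul_of_nonneg_right hji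
    (mul_nonneg (mul_nonneg hwi hwj) t1)
  nlinarith

lemma rejIncl_succ_sub_le {w : ι → ℝ} (hw : ∀ i, 0 < w i) {S : Finset ι} {m : ℤ}
    (hm0 : 0 ≤ m) (hm1 : m + 1 ≤ S.card) {R : ℝ} (hR : 1 ≤ R)
    (hratio : ∀ i ∈ S, ∀ j ∈ S, w i ≤ R * w j) {i : ι} (hi : i ∈ S) :
    |rejIncl w S (m + 1) i - rejIncl w S m i| ≤ R / S.card := by
  have h0 : 0 < esp w S m := esp_pos hw hm0 (by omega)
  have h1 : 0 < esp w S (m + 1) := esp_pos hw (by omega) hm1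
  have hZ := mul_pos h0 h1
  have hcard : (0 : ℝ) < S.card := by exact_mod_cast Finset.card_pos.2 ⟨i, hi⟩
  rw [abs_of_nonneg]
  · rw [le_div_iff₀ hcard]
    have hle : ∀ j ∈ S, rejIncl w S (m + 1) i - rejIncl w S m i ≤
        R * (rejIncl w S (m + 1) j - rejIncl w S m j) := by
      intro j hj
      rw [rejIncl_succ_sub h0.ne' h1.ne' hi, rejIncl_succ_sub h0.ne' h1.ne' hj, ← mul_div_assoc]
      exact div_le_div_of_nonneg_right
        (turan_erase_le hw m hi hj hR (hratio i hi j hj) (hratio j hj i hi)) hZ.le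
    have := Finset.sum_le_sum hle
    rw [← Finset.mul_sum, Finset.sum_const, nsmul_eq_mul, Finset.sum_sub_distrib,
      sum_rejIncl hw h0, sum_rejIncl hw h1] at this
    push_cast at this
    linarith
  · rw [rejIncl_succ_sub h0.ne' h1.ne' hi]
    exact div_nonneg (mul_nonneg (hw i).le (turan_nonneg hw _ _)) hZ.le

/-- Under bounded weight ratios, the inclusion probabilities are Lipschitz in the sample size
with a constant of order `1 / |S|`. -/
lemma abs_rejIncl_sub_le {w : ι → ℝ} (hw : ∀ i, 0 < w i) {S : Finset ι} {R : ℝ} (hR : 1 ≤ R)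
    (hratio : ∀ i ∈ S, ∀ j ∈ S, w i ≤ R * w j) {i : ι} (hi : i ∈ S) {m m' : ℕ}
    (hm : m ≤ S.card) (hm' : m' ≤ S.card) :
    |rejIncl w S m i - rejIncl w S m' i| ≤ R / S.card * |(m : ℝ) - m'| := by
  have aux : ∀ (m d : ℕ), m + d ≤ S.card →
      |rejIncl w S (m + d : ℕ) i - rejIncl w S m i| ≤ R / S.card * d := by
    intro m d
    induction d with
    | zero => intro _; simp
    | succ d ih =>
      intro hd
      have h1 := ih (by omega)
      have h2 := rejIncl_succ_sub_le hw (m := ((m + d : ℕ) : ℤ)) (by positivity)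
        (by exact_mod_cast hd) hR hratio hi
      have h3 := abs_sub_le (rejIncl w S (m + (d + 1) : ℕ) i) (rejIncl w S (m + d : ℕ) i)
        (rejIncl w S m i)
      have h4 : ((m + (d + 1) : ℕ) : ℤ) = ((m + d : ℕ) : ℤ) + 1 := by push_cast; ring
      rw [h4] at h3 ⊢
      push_cast at *
      linarith
  rcases le_total m m' with h | h
  · obtain ⟨d, rfl⟩ := Nat.exists_eq_add_of_le h
    have := aux m d hm'
    rw [abs_sub_comm, abs_sub_comm (m : ℝ)]
    push_cast at *
    simpa using this
  · obtain ⟨d, rfl⟩ := Nat.exists_eq_add_of_le h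
    have := aux m' d hm
    push_cast at *
    simpa using this

lemma second_moment_le_of_nonneg {w : ι → ℝ} (hw : ∀ i, 0 < w i) {S : Finset ι} (m : ℤ)
    {b : ι → ℝ} (hb : ∀ i, 0 ≤ b i) :
    ∑ t ∈ S.powerset, sizeWeight w m t * (∑ i ∈ S, b i * (memInd i t - rejIncl w S m i)) ^ 2 ≤
      esp w S m * ∑ i ∈ S, b i ^ 2 := by
  have cov : ∀ i ∈ S, ∀ j ∈ S,
      b i * b j * ∑ t ∈ S.powerset, sizeWeight w m t *
        ((memInd i t - rejIncl w S m i) * (memInd j t - rejIncl w S m j)) ≤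
      if i = j then esp w S m * b i ^ 2 else 0 := by
    intro i hi j hj
    split_ifs with h
    · subst h
      rw [← sq, mul_comm]
      refine mul_le_mul_of_nonneg_right (Finset.sum_le_sum fun t _ => ?_) (sq_nonneg _)
      refine mul_le_of_le_one_right (sizeWeight_nonneg hw m t) ?_
      have := rejIncl_nonneg hw S m i
      have := rejIncl_le_one hw m hi
      unfold memInd
      split_ifs <;> nlinarith
    · refine mul_nonpos_of_nonneg_of_nonpos (mul_nonneg (hb i) (hb j)) ?_
      have key := pair_sum_mul_esp_le hw m hi hj h
      have hi1 := memInd_sum_eq_rejIncl hw m hi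
      have hj1 := memInd_sum_eq_rejIncl hw m hj
      have e : ∑ t ∈ S.powerset, sizeWeight w m t *
          ((memInd i t - rejIncl w S m i) * (memInd j t - rejIncl w S m j)) =
          ∑ t ∈ S.powerset, sizeWeight w m t * (memInd i t * memInd j t) -
            esp w S m * (rejIncl w S m i * rejIncl w S m j) := by
        calc _ = ∑ t ∈ S.powerset, sizeWeight w m t * (memInd i t * memInd j t)
              - (∑ t ∈ S.powerset, sizeWeight w m t * memInd i t) * rejIncl w S m j
              - (∑ t ∈ S.powerset, sizeWeight w m t * memInd j t) * rejIncl w S m i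
              + esp w S m * (rejIncl w S m i * rejIncl w S m j) := by
              rw [esp, Finset.sum_mul, Finset.sum_mul, Finset.sum_mul,
                ← Finset.sum_sub_distrib, ← Finset.sum_sub_distrib, ← Finset.sum_add_distrib]
              exact Finset.sum_congr rfl fun t _ => by ring
          _ = _ := by rw [hi1, hj1]; ring
      rw [e]
      rw [hi1, hj1] at key
      rcases (esp_nonneg hw S m).lt_or_eq with hZ | hZ
      · have : ∑ t ∈ S.powerset, sizeWeight w m t * (memInd i t * memInd j t) ≤
            esp w S m * (rejIncl w S m i * rejIncl w S m j) := by
          refine le_of_mul_le_mul_right ?_ hZ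
          linarith
        linarith
      · rw [← hZ, zero_mul, sub_zero]
        refine (Finset.sum_le_sum fun t _ => ?_).trans hZ.ge
        refine mul_le_of_le_one_right (sizeWeight_nonneg hw m t) ?_
        unfold memInd
        split_ifs <;> norm_num
  calc _ = ∑ i ∈ S, ∑ j ∈ S, b i * b j * ∑ t ∈ S.powerset, sizeWeight w m t *
        ((memInd i t - rejIncl w S m i) * (memInd j t - rejIncl w S m j)) := by
        simp_rw [sq, Finset.sum_mul_sum, Finset.mul_sum]
        rw [Finset.sum_comm]
        refine Finset.sum_congr rfl fun i _ => ?_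
        rw [Finset.sum_comm]
        exact Finset.sum_congr rfl fun j _ => Finset.sum_congr rfl fun t _ => by ring
    _ ≤ ∑ i ∈ S, ∑ j ∈ S, if i = j then esp w S m * b i ^ 2 else 0 :=
        Finset.sum_le_sum fun i hi => Finset.sum_le_sum fun j hj => cov i hi j hj
    _ = _ := by
        rw [Finset.mul_sum]
        refine Finset.sum_congr rfl fun i hi => ?_
        rw [Finset.sum_ite_eq, if_pos hi]

lemma second_moment_le {w : ι → ℝ} (hw : ∀ i, 0 < w i) (S : Finset ι) (m : ℤ) (b : ι → ℝ) :
    ∑ t ∈ S.powerset, sizeWeight w m t * (∑ i ∈ S, b i * (memInd i t - rejIncl w S m i)) ^ 2 ≤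
      2 * (esp w S m * ∑ i ∈ S, b i ^ 2) := by
  have hp := second_moment_le_of_nonneg hw (S := S) m (b := fun i => (b i)⁺)
    fun i => posPart_nonneg _
  have hn := second_moment_le_of_nonneg hw (S := S) m (b := fun i => (b i)⁻)
    fun i => negPart_nonneg _
  have hsq : ∀ i, (b i)⁺ ^ 2 + (b i)⁻ ^ 2 = b i ^ 2 := by
    intro i
    rcases le_total 0 (b i) with h | h
    · simp [posPart_eq_self.2 h, negPart_eq_zero.2 h]
    · simp [posPart_eq_zero.2 h, negPart_eq_neg.2 h]
  have hle : ∀ t ∈ S.powerset,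
      sizeWeight w m t * (∑ i ∈ S, b i * (memInd i t - rejIncl w S m i)) ^ 2 ≤
      2 * (sizeWeight w m t * (∑ i ∈ S, (b i)⁺ * (memInd i t - rejIncl w S m i)) ^ 2) +
      2 * (sizeWeight w m t * (∑ i ∈ S, (b i)⁻ * (memInd i t - rejIncl w S m i)) ^ 2) := by
    intro t _
    have e : ∑ i ∈ S, b i * (memInd i t - rejIncl w S m i) =
        ∑ i ∈ S, (b i)⁺ * (memInd i t - rejIncl w S m i) -
          ∑ i ∈ S, (b i)⁻ * (memInd i t - rejIncl w S m i) := by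
      rw [← Finset.sum_sub_distrib]
      exact Finset.sum_congr rfl fun i _ => by rw [← sub_mul, posPart_sub_negPart]
    rw [e]
    set x := ∑ i ∈ S, (b i)⁺ * (memInd i t - rejIncl w S m i)
    set y := ∑ i ∈ S, (b i)⁻ * (memInd i t - rejIncl w S m i)
    have h1 : (x - y) ^ 2 ≤ 2 * x ^ 2 + 2 * y ^ 2 := by nlinarith [sq_nonneg (x + y)]
    have h2 := mul_le_mul_of_nonneg_left h1 (sizeWeight_nonneg hw m t)
    linarith
  refine (Finset.sum_le_sum hle).trans ?_
  rw [Finset.sum_add_distrib, ← Finset.mul_sum, ← Finset.mul_sum]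
  have : ∑ i ∈ S, b i ^ 2 = ∑ i ∈ S, (b i)⁺ ^ 2 + ∑ i ∈ S, (b i)⁻ ^ 2 := by
    rw [← Finset.sum_add_distrib]
    exact Finset.sum_congr rfl fun i _ => (hsq i).symm
  rw [this, mul_add]
  linarith

end ElementarySymmetric

section Conditioning

variable {ι : Type*} [DecidableEq ι]

lemma sum_powerset_sdiff_union {S U : Finset ι} (hU : U ⊆ S) (F : Finset ι → ℝ) :
    ∑ s ∈ S.powerset, F s = ∑ B ∈ (S \ U).powerset, ∑ t ∈ U.powerset, F (B ∪ t) := by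
  rw [← Finset.sum_product']
  refine Finset.sum_bij' (fun s _ => (s \ U, s ∩ U)) (fun x _ => x.1 ∪ x.2) ?_ ?_ ?_ ?_ ?_
  · intro s hs
    rw [Finset.mem_powerset] at hs
    simp only [Finset.mem_product, Finset.mem_powerset]
    exact ⟨Finset.sdiff_subset_sdiff hs le_rfl, Finset.inter_subset_right⟩
  · rintro ⟨B, t⟩ h
    simp only [Finset.mem_product, Finset.mem_powerset] at h ⊢
    exact Finset.union_subset (h.1.trans Finset.sdiff_subset) (h.2.trans hU)
  · intro s _
    exact Finset.sdiff_union_inter s U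
  · rintro ⟨B, t⟩ h
    simp only [Finset.mem_product, Finset.mem_powerset] at h
    have hB : Disjoint B U := Finset.disjoint_of_subset_left h.1 Finset.sdiff_disjoint
    ext x
    · have hxB : x ∈ B → x ∉ U := fun hx => Finset.disjoint_left.1 hB hx
      have hx : x ∈ t → x ∈ U := fun hx => h.2 hx
      simp only [Finset.mem_sdiff, Finset.mem_union]
      tauto
    · have hxB : x ∈ B → x ∉ U := fun hx => Finset.disjoint_left.1 hB hx
      have hx : x ∈ t → x ∈ U := fun hx => h.2 hx
      simp only [Finset.mem_inter, Finset.mem_union]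
      tauto
  · intro s _
    exact (congrArg F (Finset.sdiff_union_inter s U)).symm

lemma sizeWeight_union (w : ι → ℝ) (m : ℤ) {B t : Finset ι} (h : Disjoint B t) :
    sizeWeight w m (B ∪ t) = (∏ i ∈ B, w i) * sizeWeight w (m - B.card) t := by
  unfold sizeWeight
  rw [Finset.card_union_of_disjoint h, Finset.prod_union h]
  push_cast
  by_cases h' : (t.card : ℤ) = m - B.card
  · rw [if_pos h', if_pos (by omega)]
  · rw [if_neg h', if_neg (by omega), mul_zero]

lemma disjoint_of_mem_powerset_sdiff {S U B t : Finset ι} (hB : B ∈ (S \ U).powerset)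
    (ht : t ∈ U.powerset) : Disjoint B t :=
  Finset.disjoint_of_subset_left (Finset.mem_powerset.1 hB)
    (Finset.disjoint_of_subset_right (Finset.mem_powerset.1 ht) Finset.sdiff_disjoint)

lemma union_inter_of_mem_powerset {S U B t : Finset ι} (hB : B ∈ (S \ U).powerset)
    (ht : t ∈ U.powerset) : (B ∪ t) ∩ U = t := by
  have h1 := disjoint_of_mem_powerset_sdiff hB (Finset.mem_powerset_self U)
  rw [Finset.union_inter_distrib_right, Finset.disjoint_iff_inter_eq_empty.1 h1,
    Finset.empty_union, Finset.inter_eq_left.2 (Finset.mem_powerset.1 ht)]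

/-- Conditionally on the part of the sample outside `U`, the sample inside `U` is rejective. -/
lemma sum_sizeWeight_memInd_eq_cond {w : ι → ℝ} (hw : ∀ i, 0 < w i) {S U : Finset ι}
    (hU : U ⊆ S) (m : ℤ) {i : ι} (hi : i ∈ U) :
    ∑ s ∈ S.powerset, sizeWeight w m s * memInd i s =
      ∑ s ∈ S.powerset, sizeWeight w m s * rejIncl w U ((s ∩ U).card : ℕ) i := by
  rw [sum_powerset_sdiff_union hU, sum_powerset_sdiff_union hU]
  refine Finset.sum_congr rfl fun B hB => ?_
  have hiB : i ∉ B := fun h => (Finset.mem_sdiff.1 (Finset.mem_powerset.1 hB h)).2 hi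
  calc _ = (∏ i ∈ B, w i) *
        ∑ t ∈ U.powerset, sizeWeight w (m - B.card) t * memInd i t := by
        rw [Finset.mul_sum]
        refine Finset.sum_congr rfl fun t ht => ?_
        rw [sizeWeight_union w m (disjoint_of_mem_powerset_sdiff hB ht), mul_assoc]
        simp [memInd, hiB]
    _ = (∏ i ∈ B, w i) *
        ∑ t ∈ U.powerset, sizeWeight w (m - B.card) t * rejIncl w U (t.card : ℕ) i := by
        rw [memInd_sum_eq_rejIncl hw _ hi, esp, Finset.sum_mul]
        congr 1
        refine Finset.sum_congr rfl fun t _ => sizeWeight_mul_congr w fun h => ?_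
        rw [h]
    _ = _ := by
        rw [Finset.mul_sum]
        refine Finset.sum_congr rfl fun t ht => ?_
        rw [sizeWeight_union w m (disjoint_of_mem_powerset_sdiff hB ht), mul_assoc,
          union_inter_of_mem_powerset hB ht]

/-- The variance of the number of sampled elements of `U` is at most `|U|`. -/
lemma sum_sizeWeight_count_sq_le {w : ι → ℝ} (hw : ∀ i, 0 < w i) {S U : Finset ι}
    (hU : U ⊆ S) (m : ℤ) :
    ∑ s ∈ S.powerset,
        sizeWeight w m s * (((s ∩ U).card : ℝ) - ∑ i ∈ U, rejIncl w S m i) ^ 2 ≤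
      esp w S m * U.card := by
  have h := second_moment_le_of_nonneg hw (S := S) m (b := fun i => memInd i U)
    fun i => by unfold memInd; split_ifs <;> norm_num
  have restrict : ∀ f : ι → ℝ, ∑ i ∈ S, memInd i U * f i = ∑ i ∈ U, f i := by
    intro f
    simp only [memInd, ite_mul, one_mul, zero_mul]
    rw [Finset.sum_ite_mem, Finset.inter_eq_right.2 hU]
  have hsq : ∑ i ∈ S, memInd i U ^ 2 = U.card := by
    simp only [sq, restrict]
    exact memInd_sum U U le_rfl
  rw [hsq] at h
  refine le_trans (Finset.sum_le_sum fun s _ => le_of_eq ?_) h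
  rw [restrict, Finset.sum_sub_distrib]
  congr 3
  simp [memInd, Finset.inter_comm]

lemma abs_rejIncl_sub_rejIncl_le {w : ι → ℝ} (hw : ∀ i, 0 < w i) {S U : Finset ι}
    (hU : U ⊆ S) {m : ℤ} (hZ : 0 < esp w S m) {R : ℝ} (hR : 1 ≤ R)
    (hratio : ∀ i ∈ U, ∀ j ∈ U, w i ≤ R * w j) {τ : ℝ} {m₀ : ℕ} (hm₀ : m₀ ≤ U.card)
    (hdev : |(m₀ : ℝ) - ∑ i ∈ U, rejIncl w S m i| ≤ τ * √U.card) {i : ι} (hi : i ∈ U) :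
    |rejIncl w U m₀ i - rejIncl w S m i| ≤ R * (τ + 1) / √U.card := by
  have hcard : (0 : ℝ) < U.card := by exact_mod_cast Finset.card_pos.2 ⟨i, hi⟩
  have hs := Real.sqrt_pos.2 hcard
  have hss := Real.mul_self_sqrt hcard.le
  set r := √(U.card : ℝ)
  set μ := ∑ i ∈ U, rejIncl w S m i
  set Z := esp w S m with hZdef
  have hvar := sum_sizeWeight_count_sq_le hw hU m
  have hdiff : Z * (rejIncl w U m₀ i - rejIncl w S m i) = ∑ s ∈ S.powerset,
      sizeWeight w m s * (rejIncl w U m₀ i - rejIncl w U ((s ∩ U).card : ℕ) i) := by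
    simp_rw [mul_sub, Finset.sum_sub_distrib]
    rw [← sum_sizeWeight_memInd_eq_cond hw hU m hi, memInd_sum_eq_rejIncl hw m (hU hi), hZdef, esp,
      Finset.sum_mul]
  have hterm : ∀ s ∈ S.powerset,
      |sizeWeight w m s * (rejIncl w U m₀ i - rejIncl w U ((s ∩ U).card : ℕ) i)| ≤
      R / U.card * (sizeWeight w m s * (τ * r + r / 2) +
        (2 * r)⁻¹ * (sizeWeight w m s * (((s ∩ U).card : ℝ) - μ) ^ 2)) := by
    intro s _
    have hsw := sizeWeight_nonneg hw m s
    rw [abs_mul, abs_of_nonneg hsw]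
    have h1 := abs_rejIncl_sub_le hw hR hratio hi hm₀
      (Finset.card_le_card (Finset.inter_subset_right (s₁ := s)))
    have h2 : |(m₀ : ℝ) - (s ∩ U).card| ≤ τ * r + |((s ∩ U).card : ℝ) - μ| := by
      have := abs_sub_le (m₀ : ℝ) μ (s ∩ U).card
      rw [abs_sub_comm μ] at this
      linarith
    have h3 : |((s ∩ U).card : ℝ) - μ| ≤ r / 2 + (2 * r)⁻¹ * (((s ∩ U).card : ℝ) - μ) ^ 2 := by
      rw [← sq_abs]
      set x := |((s ∩ U).card : ℝ) - μ|
      have : r / 2 + (2 * r)⁻¹ * x ^ 2 - x = (2 * r)⁻¹ * (x - r) ^ 2 := by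
        field_simp
        ring
      have : 0 ≤ (2 * r)⁻¹ * (x - r) ^ 2 := by positivity
      linarith
    calc _ ≤ sizeWeight w m s * (R / U.card *
          (τ * r + (r / 2 + (2 * r)⁻¹ * (((s ∩ U).card : ℝ) - μ) ^ 2))) := by
          refine mul_le_mul_of_nonneg_left (h1.trans ?_) hsw
          refine mul_le_mul_of_nonneg_left (by linarith) (by positivity)
      _ = _ := by ring
  have hsum : Z * |rejIncl w U m₀ i - rejIncl w S m i| ≤
      R / U.card * (Z * (τ * r + r / 2) + (2 * r)⁻¹ * (Z * U.card)) := by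
    rw [← abs_of_pos hZ, ← abs_mul, abs_of_pos hZ, hdiff]
    refine (Finset.abs_sum_le_sum_abs _ _).trans ((Finset.sum_le_sum hterm).trans ?_)
    rw [← Finset.mul_sum, Finset.sum_add_distrib, ← Finset.sum_mul, ← Finset.mul_sum]
    refine mul_le_mul_of_nonneg_left ?_ (by positivity)
    exact add_le_add le_rfl (mul_le_mul_of_nonneg_left hvar (by positivity))
  refine le_of_mul_le_mul_left (hsum.trans (le_of_eq ?_)) hZ
  rw [← hss]
  field_simp
  ring

/-- The conditional second moment of the fold fluctuation under rejective sampling from `U`. -/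
lemma sum_sizeWeight_fluct_sq_le {w : ι → ℝ} (hw : ∀ i, 0 < w i) {U : Finset ι}
    (hne : U.Nonempty) (m : ℤ) {p L : ℝ} (hp : 0 < p) {π : ι → ℝ} (hπ : ∀ i ∈ U, p ≤ π i)
    (hbias : ∀ i ∈ U, |rejIncl w U m i - π i| ≤ L / √U.card) (a : ι → ℝ) :
    ∑ t ∈ U.powerset,
        sizeWeight w m t * ((U.card : ℝ)⁻¹ * ∑ i ∈ U, (memInd i t / π i - 1) * a i) ^ 2 ≤
      esp w U m *
        (2 * (2 + L ^ 2) / p ^ 2 / U.card * ((U.card : ℝ)⁻¹ * ∑ i ∈ U, a i ^ 2)) := by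
  have hcard : (0 : ℝ) < U.card := by exact_mod_cast Finset.card_pos.2 hne
  have hss := Real.mul_self_sqrt hcard.le
  have hmom := second_moment_le hw U m fun i => a i / π i
  set A := ∑ i ∈ U, a i ^ 2
  have hdiv : ∑ i ∈ U, (a i / π i) ^ 2 ≤ A / p ^ 2 := by
    rw [Finset.sum_div]
    refine Finset.sum_le_sum fun i hi => ?_
    rw [div_pow]
    exact div_le_div_of_nonneg_left (sq_nonneg _) (by positivity)
      (pow_le_pow_left₀ hp.le (hπ i hi) 2)
  set β := ∑ i ∈ U, (rejIncl w U m i - π i) * (a i / π i)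
  have hβ : β ^ 2 ≤ L ^ 2 * (A / p ^ 2) := by
    refine (Finset.sum_mul_sq_le_sq_mul_sq _ _ _).trans ?_
    refine mul_le_mul ?_ hdiv (Finset.sum_nonneg fun _ _ => sq_nonneg _) (sq_nonneg _)
    calc _ ≤ ∑ i ∈ U, L ^ 2 / U.card := by
          refine Finset.sum_le_sum fun i hi => ?_
          rw [← sq_abs]
          refine (pow_le_pow_left₀ (abs_nonneg _) (hbias i hi) 2).trans (le_of_eq ?_)
          rw [div_pow, sq √_, hss]
      _ = L ^ 2 := by
          rw [Finset.sum_const, nsmul_eq_mul]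
          field_simp
  have hterm : ∀ t ∈ U.powerset,
      sizeWeight w m t * ((U.card : ℝ)⁻¹ * ∑ i ∈ U, (memInd i t / π i - 1) * a i) ^ 2 ≤
      2 / (U.card : ℝ) ^ 2 * (sizeWeight w m t *
        (∑ i ∈ U, a i / π i * (memInd i t - rejIncl w U m i)) ^ 2 +
          sizeWeight w m t * β ^ 2) := by
    intro t _
    have e : ∑ i ∈ U, (memInd i t / π i - 1) * a i =
        ∑ i ∈ U, a i / π i * (memInd i t - rejIncl w U m i) + β := by
      rw [← Finset.sum_add_distrib]
      refine Finset.sum_congr rfl fun i hi => ?_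
      have : π i ≠ 0 := (hp.trans_le (hπ i hi)).ne'
      field_simp
      ring
    rw [e]
    set x := ∑ i ∈ U, a i / π i * (memInd i t - rejIncl w U m i)
    have h1 : (x + β) ^ 2 ≤ 2 * (x ^ 2 + β ^ 2) := by nlinarith [sq_nonneg (x - β)]
    calc _ = sizeWeight w m t * ((U.card : ℝ) ^ 2)⁻¹ * (x + β) ^ 2 := by
          rw [mul_pow, inv_pow]; ring
      _ ≤ sizeWeight w m t * ((U.card : ℝ) ^ 2)⁻¹ * (2 * (x ^ 2 + β ^ 2)) :=
          mul_le_mul_of_nonneg_left h1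
            (mul_nonneg (sizeWeight_nonneg hw m t) (by positivity))
      _ = _ := by ring
  have hZ := esp_nonneg hw U m
  calc _ ≤ _ := Finset.sum_le_sum hterm
    _ = 2 / (U.card : ℝ) ^ 2 * (∑ t ∈ U.powerset, sizeWeight w m t *
        (∑ i ∈ U, a i / π i * (memInd i t - rejIncl w U m i)) ^ 2 + esp w U m * β ^ 2) := by
        rw [← Finset.mul_sum, Finset.sum_add_distrib, esp, Finset.sum_mul]
    _ ≤ 2 / (U.card : ℝ) ^ 2 * (2 * (esp w U m * (A / p ^ 2)) +
          esp w U m * (L ^ 2 * (A / p ^ 2))) := by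
        refine mul_le_mul_of_nonneg_left (add_le_add (hmom.trans ?_) ?_) (by positivity)
        · exact mul_le_mul_of_nonneg_left (mul_le_mul_of_nonneg_left hdiv hZ) (by norm_num)
        · exact mul_le_mul_of_nonneg_left hβ hZ
    _ = _ := by
        field_simp

/-- The second moment bound on the fibre of samples with a prescribed part `B` outside `U`. -/
lemma sum_fibre_fluct_sq_le {w : ι → ℝ} (hw : ∀ i, 0 < w i) {S U B : Finset ι} (hU : U ⊆ S)
    (hB : B ⊆ S \ U) {m : ℤ} (hZ : 0 < esp w S m) (hne : U.Nonempty) {R : ℝ} (hR : 1 ≤ R)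
    (hratio : ∀ i ∈ U, ∀ j ∈ U, w i ≤ R * w j) {τ p : ℝ} (hp : 0 < p)
    (hπ : ∀ i ∈ U, p ≤ rejIncl w S m i) {m₀ : ℕ} (hm : m = B.card + m₀) (hm₀ : m₀ ≤ U.card)
    (hdev : |(m₀ : ℝ) - ∑ i ∈ U, rejIncl w S m i| ≤ τ * √U.card) (a : ι → ℝ) :
    ∑ s ∈ S.powerset, (if s \ U = B then sizeWeight w m s else 0) *
        ((U.card : ℝ)⁻¹ * ∑ i ∈ U, (memInd i s / rejIncl w S m i - 1) * a i) ^ 2 ≤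
      (∑ s ∈ S.powerset, if s \ U = B then sizeWeight w m s else 0) *
        (2 * (2 + (R * (τ + 1)) ^ 2) / p ^ 2 / U.card *
          ((U.card : ℝ)⁻¹ * ∑ i ∈ U, a i ^ 2)) := by
  have hBm : B ∈ (S \ U).powerset := Finset.mem_powerset.2 hB
  have fibre : ∀ F : Finset ι → ℝ,
      ∑ s ∈ S.powerset, (if s \ U = B then sizeWeight w m s else 0) * F s =
        (∏ i ∈ B, w i) * ∑ t ∈ U.powerset, sizeWeight w m₀ t * F (B ∪ t) := by
    intro F
    rw [sum_powerset_sdiff_union hU, Finset.sum_eq_single_of_mem B hBm, Finset.mul_sum]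
    · refine Finset.sum_congr rfl fun t ht => ?_
      have hd := disjoint_of_mem_powerset_sdiff hBm ht
      rw [if_pos, sizeWeight_union w m hd, mul_assoc, hm, add_sub_cancel_left]
      rw [Finset.union_sdiff_distrib, Finset.sdiff_eq_empty_iff_subset.2
        (Finset.mem_powerset.1 ht), Finset.union_empty, Finset.sdiff_eq_self_of_disjoint]
      exact disjoint_of_mem_powerset_sdiff hBm (Finset.mem_powerset_self U)
    · intro B' hB' hne
      refine Finset.sum_eq_zero fun t ht => ?_
      rw [if_neg, zero_mul]
      rwa [Finset.union_sdiff_distrib, Finset.sdiff_eq_empty_iff_subset.2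
        (Finset.mem_powerset.1 ht), Finset.union_empty, Finset.sdiff_eq_self_of_disjoint]
      exact disjoint_of_mem_powerset_sdiff hB' (Finset.mem_powerset_self U)
  have htot := fibre fun _ => 1
  simp only [mul_one] at htot
  rw [fibre, htot, mul_assoc]
  refine mul_le_mul_of_nonneg_left ?_ (Finset.prod_nonneg fun i _ => (hw i).le)
  refine le_trans (Finset.sum_le_sum fun t _ => le_of_eq ?_)
    (sum_sizeWeight_fluct_sq_le hw hne m₀ hp hπ
      (fun i hi => abs_rejIncl_sub_rejIncl_le hw hU hZ hR hratio hm₀ hdev hi) a)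
  congr 3
  refine Finset.sum_congr rfl fun i hi => ?_
  have hiB : i ∉ B := fun h => (Finset.mem_sdiff.1 (hB h)).2 hi
  simp [memInd, hiB]

end Conditioning

section Conditional

variable {Ω : Type*}

lemma eq_of_measurable_comap {β : Type*} [mβ : MeasurableSpace β] {g : Ω → β} {f : Ω → ℝ}
    (hf : Measurable[MeasurableSpace.comap g mβ] f) {x y : Ω} (h : g x = g y) : f x = f y := by
  obtain ⟨T, _, hT⟩ := hf (measurableSet_singleton (f y))
  have hy : y ∈ g ⁻¹' T := by rw [hT]; rfl
  have hx : x ∈ g ⁻¹' T := by rwa [Set.mem_preimage, h]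
  rw [hT] at hx
  exact hx

variable [mΩ : MeasurableSpace Ω]

/-- A bound on the atoms of a finitely generated sigma-field bounds the conditional
expectation. -/
lemma condExp_comap_le_of_fibre {β : Type*} [Countable β] [mβ : MeasurableSpace β]
    [MeasurableSingletonClass β] (P : Measure Ω) [IsProbabilityMeasure P] {g : Ω → β}
    (hg : Measurable g) {h φ : Ω → ℝ} (hInt : Integrable h P) {good : Ω → Prop}
    (hfib : ∀ x, good x → ∫ y in g ⁻¹' {g x}, h y ∂P ≤ P.real (g ⁻¹' {g x}) * φ x) :
    ∀ᵐ x ∂P, good x → (P[h | MeasurableSpace.comap g mβ]) x ≤ φ x := by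
  have hm : MeasurableSpace.comap g mβ ≤ mΩ := hg.comap_le
  have hpos : ∀ᵐ x ∂P, ∀ v, g x = v → P (g ⁻¹' {v}) ≠ 0 := by
    rw [ae_all_iff]
    intro v
    by_cases h0 : P (g ⁻¹' {v}) = 0
    · filter_upwards [measure_eq_zero_iff_ae_notMem.1 h0] with x hx hxv
      exact absurd hxv hx
    · exact Eventually.of_forall fun _ _ => h0
  filter_upwards [hpos] with x hx hgood
  have hT : MeasurableSet[MeasurableSpace.comap g mβ] (g ⁻¹' {g x}) :=
    ⟨{g x}, measurableSet_singleton _, rfl⟩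
  have hconst : ∀ y ∈ g ⁻¹' {g x}, (P[h | MeasurableSpace.comap g mβ]) y =
      (P[h | MeasurableSpace.comap g mβ]) x := fun y hy =>
    eq_of_measurable_comap stronglyMeasurable_condExp.measurable hy
  have h1 := setIntegral_condExp hm hInt hT
  rw [setIntegral_congr_fun (hm _ hT) hconst, setIntegral_const, smul_eq_mul] at h1
  have hpos' : 0 < P.real (g ⁻¹' {g x}) :=
    ENNReal.toReal_pos (hx _ rfl) (measure_ne_top _ _)
  refine le_of_mul_le_mul_left ?_ hpos'
  rw [h1]
  exact hfib x hgood

end Conditional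

section Design

variable {Ω : Type*} {N K : ℕ} {κ : Ω → Fin N → Fin K}

lemma fold_congr {k : Fin K} {ω ω' : Ω} (h : κ ω = κ ω') : fold κ k ω = fold κ k ω' := by
  unfold fold
  rw [h]

lemma rejectiveNorm_eq_esp (n : ℕ) (w : Fin N → ℝ) :
    rejectiveNorm n w = esp w Finset.univ n := by
  rw [rejectiveNorm, esp, Finset.powersetCard_eq_filter, Finset.sum_filter]
  exact Finset.sum_congr rfl fun t _ => by simp [sizeWeight]

variable [mΩ : MeasurableSpace Ω] {P : Measure Ω} {A : Ω → Finset (Fin N)} {n : ℕ} {w : Fin N → ℝ}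

/-- The deviation of the realized fold sample size from its expectation. -/
def countDev (P : Measure Ω) (A : Ω → Finset (Fin N)) (κ : Ω → Fin N → Fin K) (k : Fin K)
    (ω : Ω) : ℝ :=
  ((A ω ∩ fold κ k ω).card : ℝ) - ∑ i ∈ fold κ k ω, inclProb P A i

/-- The event that the fold sample size deviates by more than `τ √N_k` from its expectation. -/
def badEvent (P : Measure Ω) (A : Ω → Finset (Fin N)) (κ : Ω → Fin N → Fin K) (τ : ℝ)
    (k : Fin K) : Set Ω :=
  {ω | τ ^ 2 * (fold κ k ω).card < countDev P A κ k ω ^ 2}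

lemma measurableSet_of_label_sample (hA : Measurable A) (hκ : Measurable κ)
    (Q : (Fin N → Fin K) → Finset (Fin N) → Prop) : MeasurableSet {ω | Q (κ ω) (A ω)} :=
  (hκ.prodMk hA) (Set.toFinite {x : (Fin N → Fin K) × Finset (Fin N) | Q x.1 x.2}).measurableSet

lemma measurableSet_badEvent (hA : Measurable A) (hκ : Measurable κ) (τ : ℝ) (k : Fin K) :
    MeasurableSet (badEvent P A κ τ k) :=
  measurableSet_of_label_sample hA hκ fun l s =>
    τ ^ 2 * ((Finset.univ.filter fun i => l i = k).card : ℝ) <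
      (((s ∩ Finset.univ.filter fun i => l i = k).card : ℝ) -
        ∑ i ∈ Finset.univ.filter fun i => l i = k, inclProb P A i) ^ 2

lemma measurable_trainMap (hA : Measurable A) (hκ : Measurable κ) (k : Fin K) :
    Measurable fun ω => (κ ω, A ω \ fold κ k ω) :=
  (measurable_of_finite fun x : (Fin N → Fin K) × Finset (Fin N) =>
    (x.1, x.2 \ Finset.univ.filter fun i => x.1 i = k)).comp (hκ.prodMk hA)

lemma IsRejective.law_eq (hrej : IsRejective P A n w) (s : Finset (Fin N)) :
    P.real (A ⁻¹' {s}) = sizeWeight w n s / esp w Finset.univ n := by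
  by_cases hs : s.card = n
  · rw [sizeWeight, if_pos (by exact_mod_cast hs), ← rejectiveNorm_eq_esp]
    exact hrej.law s hs
  · rw [sizeWeight, if_neg (by exact_mod_cast hs), zero_div, Measure.real,
      measure_eq_zero_iff_ae_notMem.2, ENNReal.toReal_zero]
    filter_upwards [hrej.size] with ω hω h
    rw [Set.mem_preimage, Set.mem_singleton_iff] at h
    exact hs (h ▸ hω)

variable [IsProbabilityMeasure P]

lemma IsRejective.size_le (hrej : IsRejective P A n w) : n ≤ N := by
  obtain ⟨ω, hω⟩ := hrej.size.exists
  rw [← hω]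
  simpa using Finset.card_le_univ (A ω)

lemma IsRejective.esp_pos (hrej : IsRejective P A n w) : 0 < esp w Finset.univ n :=
  SurveySampling.esp_pos hrej.weight_pos (by positivity) (by simpa using hrej.size_le)

/-- Expectations of functions of the fold labels and the sample as finite sums. -/
lemma IsRejective.integral_eq (hrej : IsRejective P A n w) (hA : Measurable A)
    (hκ : Measurable κ) (hind : IndepFun A κ P)
    (H : (Fin N → Fin K) → Finset (Fin N) → ℝ) :
    ∫ ω, H (κ ω) (A ω) ∂P = ∑ l, P.real (κ ⁻¹' {l}) *
      ∑ s, sizeWeight w n s / esp w Finset.univ n * H l s := by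
  have hpair : Measurable fun ω => (κ ω, A ω) := hκ.prodMk hA
  have hprob : IsProbabilityMeasure (P.map fun ω => (κ ω, A ω)) :=
    Measure.isProbabilityMeasure_map hpair.aemeasurable
  have h1 : ∫ ω, H (κ ω) (A ω) ∂P =
      ∫ x, H x.1 x.2 ∂(P.map fun ω => (κ ω, A ω)) := by
    rw [integral_map hpair.aemeasurable]
    exact (measurable_of_finite _).aestronglyMeasurable
  rw [h1, integral_fintype Integrable.of_finite, Fintype.sum_prod_type]
  refine Finset.sum_congr rfl fun l _ => ?_
  rw [Finset.mul_sum]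
  refine Finset.sum_congr rfl fun s _ => ?_
  rw [← hrej.law_eq s, smul_eq_mul, map_measureReal_apply hpair (measurableSet_singleton _)]
  have h2 : (fun ω => (κ ω, A ω)) ⁻¹' {(l, s)} = κ ⁻¹' {l} ∩ A ⁻¹' {s} := by
    ext ω
    simp [Prod.ext_iff]
  have h3 := hind.symm.measure_inter_preimage_eq_mul {l} {s} (measurableSet_singleton _)
    (measurableSet_singleton _)
  rw [h2, Measure.real, h3, ENNReal.toReal_mul]
  simp only [Measure.real]
  ring

lemma IsRejective.inclProb_eq (hrej : IsRejective P A n w) (hA : Measurable A) (i : Fin N) :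
    inclProb P A i = rejIncl w Finset.univ n i := by
  have hZ := hrej.esp_pos
  have h1 : inclProb P A i = ∫ ω, memInd i (A ω) ∂P := by
    have hmeas : MeasurableSet {ω | i ∈ A ω} := hA (measurableSet_mem_finset i)
    rw [inclProb, ← integral_indicator_one hmeas]
    refine integral_congr_ae (Eventually.of_forall fun ω => ?_)
    simp [memInd, Set.indicator_apply]
  have h2 := hrej.integral_eq hA (κ := fun _ => (fun _ => 0 : Fin N → Fin 1)) measurable_const
    (indepFun_const_right A _) fun _ s => memInd i s
  rw [h1, h2, Fintype.sum_unique]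
  have h3 : ((fun _ => (fun _ => 0 : Fin N → Fin 1)) ⁻¹' {default} : Set Ω) = Set.univ := by
    ext ω
    simp
  rw [h3, probReal_univ, one_mul]
  have h4 := memInd_sum_eq_rejIncl hrej.weight_pos n (Finset.mem_univ i)
  rw [Finset.powerset_univ] at h4
  simp_rw [div_mul_eq_mul_div]
  rw [← Finset.sum_div, h4]
  field_simp

lemma IsRejective.measure_badEvent_le (hrej : IsRejective P A n w) (hA : Measurable A)
    (hκ : Measurable κ) (hind : IndepFun A κ P) {τ : ℝ} (hτ : 0 < τ) (k : Fin K) :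
    P.real (badEvent P A κ τ k) ≤ 1 / τ ^ 2 := by
  have hZ := hrej.esp_pos
  set F : (Fin N → Fin K) → Finset (Fin N) → ℝ := fun l s =>
    (((s ∩ Finset.univ.filter fun i => l i = k).card : ℝ) -
        ∑ i ∈ Finset.univ.filter fun i => l i = k, inclProb P A i) ^ 2 /
      ((Finset.univ.filter fun i => l i = k).card : ℝ) with hF
  have hpair : Measurable fun ω => (κ ω, A ω) := hκ.prodMk hA
  have hFint : Integrable (fun ω => F (κ ω) (A ω)) P := by
    have hprob : IsProbabilityMeasure (P.map fun ω => (κ ω, A ω)) :=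
      Measure.isProbabilityMeasure_map hpair.aemeasurable
    exact (Integrable.of_finite (μ := P.map fun ω => (κ ω, A ω))
      (f := fun x => F x.1 x.2)).comp_measurable hpair
  have hmean : ∫ ω, F (κ ω) (A ω) ∂P ≤ 1 := by
    rw [hrej.integral_eq hA hκ hind]
    have inner : ∀ l, ∑ s, sizeWeight w n s / esp w Finset.univ n * F l s ≤ 1 := by
      intro l
      have h := sum_sizeWeight_count_sq_le hrej.weight_pos
        (Finset.subset_univ (Finset.univ.filter fun i => l i = k)) n
      rw [Finset.powerset_univ] at h
      simp_rw [← hrej.inclProb_eq hA] at h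
      set U := Finset.univ.filter fun i => l i = k
      calc _ = (∑ s, sizeWeight w n s *
            (((s ∩ U).card : ℝ) - ∑ i ∈ U, inclProb P A i) ^ 2) /
              (esp w Finset.univ n * U.card) := by
            rw [Finset.sum_div]
            refine Finset.sum_congr rfl fun s _ => ?_
            rw [hF, div_mul_div_comm]
        _ ≤ 1 := div_le_one_of_le₀ h (by positivity)
    have hκsum := hrej.integral_eq hA hκ hind fun _ _ => 1
    have hone : ∑ s, sizeWeight w n s / esp w Finset.univ n = 1 := by
      rw [← Finset.sum_div, ← Finset.powerset_univ, ← esp, div_self hZ.ne']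
    simp only [integral_const, probReal_univ, smul_eq_mul, mul_one, hone] at hκsum
    rw [hκsum]
    exact Finset.sum_le_sum fun l _ => mul_le_of_le_one_right measureReal_nonneg (inner l)
  have hmarkov := mul_meas_ge_le_integral_of_nonneg
    (Eventually.of_forall fun ω => by positivity) hFint (τ ^ 2)
  have hsub : badEvent P A κ τ k ⊆ {ω | τ ^ 2 ≤ F (κ ω) (A ω)} := by
    intro ω hω
    have hω' : τ ^ 2 * (fold κ k ω).card < countDev P A κ k ω ^ 2 := hω
    have hpos : (0 : ℝ) < (fold κ k ω).card := by
      rw [Nat.cast_pos, Finset.card_pos, Finset.nonempty_iff_ne_empty]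
      intro h0
      simp [countDev, h0] at hω'
    exact ((lt_div_iff₀ hpos).2 hω').le
  rw [le_div_iff₀ (by positivity), mul_comm]
  refine le_trans ?_ (hmarkov.trans hmean)
  exact mul_le_mul_of_nonneg_left (measureReal_mono hsub) (sq_nonneg τ)

/-- The constant in the conditional fluctuation bound. -/
def fluctConst (p q c τ : ℝ) : ℝ := 2 * (2 + ((p * (1 - q))⁻¹ * (τ + 1)) ^ 2) / p ^ 2 / c

lemma integrable_fluct_sq (hA : Measurable A) (hκ : Measurable κ) (k : Fin K)
    {a : Fin N → Ω → ℝ} (ha : ∀ i, Measurable[trainField A κ k] (a i)) :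
    Integrable (fun ω => fluct P A κ k a ω ^ 2) P := by
  have hpair : Measurable fun ω => (κ ω, A ω) := hκ.prodMk hA
  have hfac : Function.FactorsThrough (fun ω => fluct P A κ k a ω ^ 2)
      (fun ω => (κ ω, A ω)) := by
    intro ω ω' h
    obtain ⟨h1, h2⟩ := Prod.ext_iff.1 h
    have h3 : fold κ k ω = fold κ k ω' := fold_congr h1
    have h4 : ∀ i, a i ω = a i ω' := fun i =>
      eq_of_measurable_comap (ha i) (Prod.ext h1 (by simp_all))
    simp only at h2
    simp only [fluct, incl, h2, h3, h4]
  obtain ⟨G, hG⟩ := (Function.factorsThrough_iff _).1 hfac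
  rw [hG]
  have hprob : IsProbabilityMeasure (P.map fun ω => (κ ω, A ω)) :=
    Measure.isProbabilityMeasure_map hpair.aemeasurable
  exact (Integrable.of_finite (μ := P.map fun ω => (κ ω, A ω)) (f := G)).comp_measurable hpair

theorem IsRejective.condExp_fluct_sq_le (hrej : IsRejective P A n w) (hA : Measurable A)
    (hκ : Measurable κ) (hind : IndepFun A κ P) {p q c τ : ℝ} (hp : 0 < p) (hq : q < 1)
    (hπ : ∀ i, p ≤ inclProb P A i ∧ inclProb P A i ≤ q) (hc : 0 < c) (hn : 0 < n)
    (hτ : 0 < τ) (k : Fin K) {a : Fin N → Ω → ℝ}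
    (ha : ∀ i, Measurable[trainField A κ k] (a i)) :
    ∀ᵐ ω ∂P, c * N ≤ (fold κ k ω).card → ω ∉ badEvent P A κ τ k →
      (P[fun ω' => fluct P A κ k a ω' ^ 2 | trainField A κ k]) ω ≤
        fluctConst p q c τ / n * foldMeanSq κ k a ω := by
  have hw := hrej.weight_pos
  have hZ := hrej.esp_pos
  have hnN := hrej.size_le
  have hincl : ∀ i, rejIncl w Finset.univ n i = inclProb P A i :=
    fun i => (hrej.inclProb_eq hA i).symm
  have hpq : 0 < p * (1 - q) := mul_pos hp (by linarith)
  have hpq1 : p * (1 - q) ≤ 1 := by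
    have i : Fin N := ⟨0, by omega⟩
    have := hπ i
    nlinarith
  set R := (p * (1 - q))⁻¹ with hRdef
  have hR : 1 ≤ R := (one_le_inv₀ hpq).2 hpq1
  have hratio : ∀ i j, w i ≤ R * w j := by
    intro i j
    have h := weight_le_of_rejIncl hw (m := n) hp.le hq.le hZ
      (fun i _ => by rw [hincl]; exact (hπ i).1) (fun i _ => by rw [hincl]; exact (hπ i).2)
      (Finset.mem_univ i) (Finset.mem_univ j)
    rw [hRdef, inv_mul_eq_div, le_div_iff₀ hpq]
    linarith
  have hmeas := measurable_trainMap (κ := κ) hA hκ k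
  have main := condExp_comap_le_of_fibre P hmeas (integrable_fluct_sq (P := P) hA hκ k ha)
    (φ := fun ω => fluctConst p q c τ / n * foldMeanSq κ k a ω)
    (good := fun ω => (A ω).card = n ∧ c * N ≤ (fold κ k ω).card ∧ ω ∉ badEvent P A κ τ k) ?_
  · filter_upwards [main, hrej.size] with ω h1 h2 h3 h4
    exact h1 ⟨h2, h3, h4⟩
  rintro ω₀ ⟨hsize, hcard, hbad⟩
  set U := fold κ k ω₀ with hU
  set B := A ω₀ \ U with hB
  have hNpos : (0 : ℝ) < N := by exact_mod_cast (by omega : 0 < N)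
  have hUpos : (0 : ℝ) < U.card := (mul_pos hc hNpos).trans_le hcard
  have hne : U.Nonempty := Finset.card_pos.1 (by exact_mod_cast hUpos)
  have hfold : ∀ ω, κ ω = κ ω₀ → fold κ k ω = U := fun ω h => fold_congr h
  set D : Finset (Fin N) → ℝ := fun s =>
    ((U.card : ℝ)⁻¹ * ∑ i ∈ U, (memInd i s / rejIncl w Finset.univ n i - 1) * a i ω₀) ^ 2
  set T := (fun ω => (κ ω, A ω \ fold κ k ω)) ⁻¹' {(κ ω₀, A ω₀ \ U)} with hT
  have hTmeas : MeasurableSet T := hmeas (measurableSet_singleton _)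
  have hTmem : ∀ ω, ω ∈ T ↔ κ ω = κ ω₀ ∧ A ω \ U = B := by
    intro ω
    simp only [hT, Set.mem_preimage, Set.mem_singleton_iff, Prod.ext_iff]
    exact and_congr_right fun h => by rw [hfold ω h]
  have fibre : ∀ G : Finset (Fin N) → ℝ, ∫ ω in T, G (A ω) ∂P =
      P.real (κ ⁻¹' {κ ω₀}) / esp w Finset.univ n *
        ∑ s, (if s \ U = B then sizeWeight w n s else 0) * G s := by
    intro G
    let H : (Fin N → Fin K) → Finset (Fin N) → ℝ := fun l s =>
      if l = κ ω₀ ∧ s \ U = B then G s else 0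
    have h1 : (T.indicator fun ω => G (A ω)) = fun ω => H (κ ω) (A ω) := by
      funext ω
      by_cases h : ω ∈ T
      · simp [H, h, (hTmem ω).1 h]
      · rw [Set.indicator_of_notMem h]
        exact (if_neg (mt (hTmem ω).2 h)).symm
    rw [← integral_indicator hTmeas, h1]
    refine (hrej.integral_eq hA hκ hind H).trans ?_
    rw [Finset.sum_eq_single_of_mem (κ ω₀) (Finset.mem_univ _), div_mul_eq_mul_div, mul_div_assoc, Finset.sum_div]
    · congr 1
      refine Finset.sum_congr rfl fun s _ => ?_
      by_cases h : s \ U = B <;> simp [H, h, div_mul_eq_mul_div]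
    · intro l _ hl
      simp [H, hl]
  have hInt : ∫ ω in T, fluct P A κ k a ω ^ 2 ∂P = ∫ ω in T, D (A ω) ∂P := by
    refine setIntegral_congr_fun hTmeas fun ω hω => ?_
    have h1 := hfold ω ((hTmem ω).1 hω).1
    have h2 : ∀ i, a i ω = a i ω₀ := fun i => eq_of_measurable_comap (ha i) hω
    simp only [fluct, h1, h2, D, hincl, incl, memInd]
  have hprob : P.real T = ∫ ω in T, (fun _ => 1 : Finset (Fin N) → ℝ) (A ω) ∂P := by
    simp
  have hdev : |((A ω₀ ∩ U).card : ℝ) - ∑ i ∈ U, rejIncl w Finset.univ n i| ≤ τ * √U.card := by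
    have h1 : countDev P A κ k ω₀ ^ 2 ≤ τ ^ 2 * U.card := not_lt.1 hbad
    simp_rw [hincl]
    refine abs_le_of_sq_le_sq ?_ (by positivity)
    rw [mul_pow, Real.sq_sqrt hUpos.le]
    exact h1
  have hfib := sum_fibre_fluct_sq_le hw (Finset.subset_univ U)
    (B := B) (Finset.sdiff_subset_sdiff (Finset.subset_univ _) le_rfl) hZ hne hR
    (fun i _ j _ => hratio i j) (τ := τ) hp (fun i _ => by rw [hincl]; exact (hπ i).1)
    (m₀ := (A ω₀ ∩ U).card)
    (by have := Finset.card_sdiff_add_card_inter (A ω₀) U; rw [hsize, ← hB] at this; omega)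
    (Finset.card_le_card Finset.inter_subset_right) hdev fun i => a i ω₀
  rw [Finset.powerset_univ] at hfib
  rw [hInt, hprob, fibre, fibre fun _ => 1, mul_assoc]
  refine mul_le_mul_of_nonneg_left ?_ (div_nonneg measureReal_nonneg hZ.le)
  simp only [mul_one]
  refine hfib.trans (mul_le_mul_of_nonneg_left ?_ (Finset.sum_nonneg fun s _ => ?_))
  · refine mul_le_mul_of_nonneg_right ?_
      (mul_nonneg (by positivity) (Finset.sum_nonneg fun _ _ => sq_nonneg _))
    have hnpos : (0 : ℝ) < n := by exact_mod_cast hn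
    rw [fluctConst, ← hRdef, div_div _ c]
    refine div_le_div_of_nonneg_left (by positivity) (by positivity) (le_trans ?_ hcard)
    exact mul_le_mul_of_nonneg_left (by exact_mod_cast hnN) hc.le
  · split_ifs
    · exact sizeWeight_nonneg hw _ _
    · exact le_rfl

end Design

section Sequence

lemma eventually_pos_of_tendsto_div {n : ℕ → ℕ} {f : ℝ} (hf0 : 0 < f)
    (hf : Tendsto (fun N : ℕ => (n N : ℝ) / N) atTop (𝓝 f)) : ∀ᶠ N in atTop, 0 < n N := by
  filter_upwards [hf.eventually (lt_mem_nhds hf0)] with N hN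
  refine Nat.pos_of_ne_zero fun h => ?_
  simp [h] at hN

lemma number_of_folds_le {N K : ℕ} (hN : 0 < N) {c : ℝ} (hc : 0 < c) {l : Fin N → Fin K}
    (hl : ∀ k, c * N ≤ ((Finset.univ.filter fun i => l i = k).card : ℝ)) : (K : ℝ) ≤ 1 / c := by
  have h1 : ∑ k, (Finset.univ.filter fun i => l i = k).card = N := by
    rw [← Finset.card_eq_sum_card_fiberwise (fun _ _ => Finset.mem_coe.2 (Finset.mem_univ _))]
    simp
  have h2 : ∑ _k : Fin K, c * N ≤ N :=
    (Finset.sum_le_sum fun k _ => hl k).trans (by exact_mod_cast h1.le)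
  have hN' : (0 : ℝ) < N := by exact_mod_cast hN
  rw [Finset.sum_const, Finset.card_univ, Fintype.card_fin, nsmul_eq_mul] at h2
  rw [le_div_iff₀ hc]
  refine le_of_mul_le_mul_right ?_ hN'
  linarith

end Sequence

end SurveySampling

end

theorem proposition3 {Ω : ℕ → Type*} [∀ N, MeasurableSpace (Ω N)]
    (P : ∀ N, Measure (Ω N)) [∀ N, IsProbabilityMeasure (P N)]
    (n K : ℕ → ℕ)
    (A : ∀ N, Ω N → Finset (Fin N)) (κ : ∀ N, Ω N → Fin N → Fin (K N))
    (hA : ∀ N, Measurable (A N)) (hκ : ∀ N, Measurable (κ N))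
    (hind : ∀ N, IndepFun (A N) (κ N) (P N))
    (w : ∀ N, Fin N → ℝ)
    (hrej : ∀ N, SurveySampling.IsRejective (P N) (A N) (n N) (w N))
    (πmin πmax : ℝ) (hmin : 0 < πmin) (hmax : πmax < 1)
    (hπ : ∀ᶠ N in atTop, ∀ i : Fin N,
      πmin ≤ SurveySampling.inclProb (P N) (A N) i ∧
        SurveySampling.inclProb (P N) (A N) i ≤ πmax)
    (f : ℝ) (hf0 : 0 < f) (hf1 : f < 1)
    (hf : Tendsto (fun N : ℕ => (n N : ℝ) / N) atTop (𝓝 f)) :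
    (∀ k : ∀ N, Fin (K N), SurveySampling.BalancedFold P κ k →
      ∀ η : ℝ, 0 < η → ∃ Cη : ℝ, ∃ Nη : ℕ, ∀ N ≥ Nη,
        ∀ a : Fin N → Ω N → ℝ,
          (∀ i, Measurable[SurveySampling.trainField (A N) (κ N) (k N)] (a i)) →
          1 - η ≤ (P N).real {ω |
            ((P N)[fun ω' => SurveySampling.fluct (P N) (A N) (κ N) (k N) a ω' ^ 2 |
              SurveySampling.trainField (A N) (κ N) (k N)]) ω
              ≤ Cη / n N * SurveySampling.foldMeanSq (κ N) (k N) a ω}) ∧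
    (SurveySampling.BalancedFolds P κ →
      SurveySampling.FoldwiseFluctuationBound P A κ n) := by
  refine ⟨?_, ?_⟩
  · rintro k ⟨c, C, hc, -, hbal⟩ η hη
    set τ := √(2 / η)
    have hτ : 0 < τ := Real.sqrt_pos.2 (by positivity)
    have hτ2 : 1 / τ ^ 2 = η / 2 := by
      rw [Real.sq_sqrt (by positivity), one_div_div]
    refine ⟨SurveySampling.fluctConst πmin πmax c τ, ?_⟩
    have hev := ((hbal.eventually (lt_mem_nhds (by linarith : 1 - η / 2 < 1))).and hπ).and
      (SurveySampling.eventually_pos_of_tendsto_div hf0 hf)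
    obtain ⟨N₀, hN₀⟩ := eventually_atTop.1 hev
    refine ⟨N₀, fun N hN a ha => ?_⟩
    obtain ⟨⟨hPbal, hπN⟩, hn⟩ := hN₀ N hN
    have hbound := (hrej N).condExp_fluct_sq_le (hA N) (hκ N) (hind N) hmin hmax hπN hc hn hτ
      (k N) ha
    have hbad := (hrej N).measure_badEvent_le (hA N) (hκ N) (hind N) hτ (k N)
    rw [hτ2] at hbad
    set G := {ω | c * N ≤ ((SurveySampling.fold (κ N) (k N) ω).card : ℝ) ∧
      ((SurveySampling.fold (κ N) (k N) ω).card : ℝ) ≤ C * N}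
    set b := SurveySampling.badEvent (P N) (A N) (κ N) τ (k N)
    have hdiff : (P N).real G ≤ (P N).real (G \ b) + (P N).real b :=
      (measureReal_mono (by rw [Set.sdiff_union_self]; exact Set.subset_union_left)).trans
        (measureReal_union_le _ _)
    refine le_trans (by linarith : 1 - η ≤ (P N).real (G \ b)) ?_
    refine ENNReal.toReal_mono (measure_ne_top _ _) (measure_mono_ae ?_)
    filter_upwards [hbound] with ω hω hmem
    exact hω hmem.1.1 hmem.2
  · rintro ⟨c, C, hc, -, hbal⟩ η hη hη1
    set τ := √(2 / (c * η))
    have hτ : 0 < τ := Real.sqrt_pos.2 (by positivity)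
    have hτ2 : 1 / τ ^ 2 = c * η / 2 := by
      rw [Real.sq_sqrt (by positivity), one_div_div]
    refine ⟨SurveySampling.fluctConst πmin πmax c τ, ?_⟩
    have hev := ((hbal.eventually (lt_mem_nhds (by linarith : 1 - η / 2 < 1))).and hπ).and
      ((SurveySampling.eventually_pos_of_tendsto_div hf0 hf).and (eventually_gt_atTop 0))
    obtain ⟨N₀, hN₀⟩ := eventually_atTop.1 hev
    refine ⟨N₀, fun N hN => ?_⟩
    obtain ⟨⟨hPbal, hπN⟩, hn, hNpos⟩ := hN₀ N hN
    set G := {ω | ∀ k : Fin (K N), c * N ≤ ((SurveySampling.fold (κ N) k ω).card : ℝ) ∧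
      ((SurveySampling.fold (κ N) k ω).card : ℝ) ≤ C * N}
    set b := fun k => SurveySampling.badEvent (P N) (A N) (κ N) τ k
    have hKc : (K N : ℝ) ≤ 1 / c := by
      have hne : G.Nonempty := by
        rw [Set.nonempty_iff_ne_empty]
        intro h0
        rw [h0, measureReal_empty] at hPbal
        linarith
      obtain ⟨ω, hω⟩ := hne
      exact SurveySampling.number_of_folds_le hNpos hc (l := κ N ω) fun k => (hω k).1
    have hunion : (P N).real (⋃ k, b k) ≤ η / 2 := by
      refine (measureReal_iUnion_fintype_le _).trans ?_
      calc _ ≤ ∑ _k : Fin (K N), c * η / 2 := Finset.sum_le_sum fun k _ => by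
            rw [← hτ2]
            exact (hrej N).measure_badEvent_le (hA N) (hκ N) (hind N) hτ k
        _ = K N * (c * η / 2) := by
            rw [Finset.sum_const, Finset.card_univ, Fintype.card_fin, nsmul_eq_mul]
        _ ≤ 1 / c * (c * η / 2) := mul_le_mul_of_nonneg_right hKc (by positivity)
        _ = η / 2 := by field_simp
    have hdiff : (P N).real G ≤ (P N).real (G \ ⋃ k, b k) + (P N).real (⋃ k, b k) :=
      (measureReal_mono (by rw [Set.sdiff_union_self]; exact Set.subset_union_left)).trans
        (measureReal_union_le _ _)
    refine ⟨G \ ⋃ k, b k, ?_, by linarith, fun k a ha => ?_⟩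
    · refine MeasurableSet.diff ?_ (MeasurableSet.iUnion fun k =>
        SurveySampling.measurableSet_badEvent (hA N) (hκ N) τ k)
      exact SurveySampling.measurableSet_of_label_sample (hA N) (hκ N) fun l _ =>
        ∀ k : Fin (K N), c * N ≤ ((Finset.univ.filter fun i => l i = k).card : ℝ) ∧
          ((Finset.univ.filter fun i => l i = k).card : ℝ) ≤ C * N
    · filter_upwards [(hrej N).condExp_fluct_sq_le (hA N) (hκ N) (hind N) hmin hmax hπN hc hn hτ
        k ha] with ω hω hmem
      exact hω (hmem.1 k).1 fun h => hmem.2 (Set.mem_iUnion.2 ⟨k, h⟩)
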